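/- Let $\Lambda$ be a right noetherian ring (associative, with unit, not necessarily commutative), and let $\operatorname{mod}\Lambda$ be the abelian category of finitely generated right $\Lambda$-modules. By a subcategory of $\operatorname{mod}\Lambda$ we mean a full additive subcategory (containing $0$ and closed under finite direct sums) that is closed under isomorphisms. A subcategory $\mathcal{C}$ is closed under extensions if for every short exact sequence $0\to L\to M\to N\to 0$ with $L,N\in\mathcal{C}$ we have $M\in\mathcal{C}$; it is closed under images (resp. kernels, cokernels) if for every map $\varphi\colon C_1\to C_2$ with $C_1,C_2\in\mathcal{C}$ we have $\operatorname{Im}\varphi\in\mathcal{C}$ (resp. $\operatorname{Ker}\varphi\in\mathcal{C}$, $\operatorname{Coker}\varphi\in\mathcal{C}$). Denote by - $\mathsf{serre}\,\Lambda$ the set of Serre subcategories (closed under submodules, quotients and extensions), - $\mathsf{tors}\,\Lambda$ the set of torsion classes (closed under quotients and extensions), - $\mathsf{torf}\,\Lambda$ the set of torsion-free classes (closed under submodules and extensions), - $\mathsf{wide}\,\Lambda$ the set of wide subcategories (closed under kernels, cokernels and extensions), - $\mathsf{ice}\,\Lambda$ the set of ICE-closed subcategories (closed under images, cokernels and extensions),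 - $\mathsf{ike}\,\Lambda$ the set of IKE-closed subcategories (closed under images, kernels and extensions), - $\mathsf{ie}\,\Lambda$ the set of IE-closed subcategories (closed under images and extensions) of $\operatorname{mod}\Lambda$. Then the following conditions are equivalent: 1. $\Lambda$ is Morita equivalent to a finite (possibly empty) direct product of right artinian local rings. 2. $\mathsf{serre}\,\Lambda=\mathsf{ie}\,\Lambda$. 3. $\mathsf{serre}\,\Lambda=\mathsf{tors}\,\Lambda=\mathsf{torf}\,\Lambda=\mathsf{wide}\,\Lambda=\mathsf{ice}\,\Lambda=\mathsf{ike}\,\Lambda=\mathsf{ie}\,\Lambda$. 4. $\mathsf{serre}\,\Lambda=\mathsf{torf}\,\Lambda$. -/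

import Mathlib

open CategoryTheory Limits

universe v u

namespace SubcatClasses

section Abelian

variable {A : Type u} [Category.{v} A] [Abelian A]

/-- A subcategory of an abelian category: a full additive subcategory (it contains a zero object
and is closed under finite direct sums) that is closed under isomorphisms. A full subcategory is
encoded by the property of belonging to it. -/
structure IsSubcategory (P : ObjectProperty A) : Prop where
  containsZero : P.ContainsZero
  closedUnderIso : P.IsClosedUnderIsomorphisms
  biprod_mem : ∀ X Y : A, P X → P Y → P (X ⊞ Y)

/-- Closure under images: the image of every map between two objects of `P` belongs to `P`. -/
def ClosedUnderImages (P : ObjectProperty A) : Prop :=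
  ∀ ⦃X Y : A⦄ (f : X ⟶ Y), P X → P Y → P (image f)

variable (A)

/-- The Serre subcategories. -/
def serre : Set (ObjectProperty A) :=
  {P | IsSubcategory P ∧ P.IsClosedUnderSubobjects ∧ P.IsClosedUnderQuotients ∧
    P.IsClosedUnderExtensions}

/-- The torsion classes. -/
def tors : Set (ObjectProperty A) :=
  {P | IsSubcategory P ∧ P.IsClosedUnderQuotients ∧ P.IsClosedUnderExtensions}

/-- The torsion-free classes. -/
def torf : Set (ObjectProperty A) :=
  {P | IsSubcategory P ∧ P.IsClosedUnderSubobjects ∧ P.IsClosedUnderExtensions}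

/-- The wide subcategories. -/
def wide : Set (ObjectProperty A) :=
  {P | IsSubcategory P ∧ P.IsClosedUnderKernels ∧ P.IsClosedUnderCokernels ∧
    P.IsClosedUnderExtensions}

/-- The ICE-closed subcategories. -/
def ice : Set (ObjectProperty A) :=
  {P | IsSubcategory P ∧ ClosedUnderImages P ∧ P.IsClosedUnderCokernels ∧
    P.IsClosedUnderExtensions}

/-- The IKE-closed subcategories. -/
def ike : Set (ObjectProperty A) :=
  {P | IsSubcategory P ∧ ClosedUnderImages P ∧ P.IsClosedUnderKernels ∧
    P.IsClosedUnderExtensions}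

/-- The IE-closed subcategories. -/
def ie : Set (ObjectProperty A) :=
  {P | IsSubcategory P ∧ ClosedUnderImages P ∧ P.IsClosedUnderExtensions}

end Abelian

/-- The category of finitely generated right modules over `R`; a right `R`-module is a module
over the opposite ring. It is abelian when `R` is right noetherian. -/
abbrev RMod (R : Type u) [Ring R] : Type (u + 1) := FGModuleCat.{u} Rᵐᵒᵖ

/-- `R` is Morita equivalent to a finite (possibly empty) direct product of right artinian local
rings. Morita equivalence of two rings is an (additive, i.e. `ℤ`-linear) equivalence of their
categories of right modules; "right artinian" is being artinian as a right module over itself;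
`IsLocalRing` is the notion for rings that need not be commutative. -/
def IsMoritaToProdArtinianLocal (R : Type u) [Ring R] : Prop :=
  ∃ (n : ℕ) (Γ : Fin n → Type u) (_ : ∀ i, Ring (Γ i)),
    (∀ i, IsLocalRing (Γ i) ∧ IsArtinianRing (Γ i)ᵐᵒᵖ) ∧
      IsMoritaEquivalent ℤ Rᵐᵒᵖ (∀ i, Γ i)ᵐᵒᵖ

end SubcatClasses

/-! Right Λ-modules are left modules over R = Λᵐᵒᵖ. All seven kinds of subcategory lie between
`serre` and `ie`, so only two implications have content.

Suppose Λ is Morita equivalent to a product of artinian local rings. Each factor has a single simple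
module, so a simple subquotient S of a finitely generated M is both a quotient and a submodule of M
(`finite_length_of_isMoritaToProdArtinianLocal`). Then S is the image of a map M → S → M. An
IE-closed class containing M thus contains its composition factors and, by extensions, everything
built from them, in particular all submodules and quotients of M.

Conversely, suppose torsion-free classes are closed under quotients. The class of modules without
nonzero artinian submodules forces R to be artinian (`isArtinianRing_of_torf_subset_serre`). Let J
be its radical; R/J is a product of matrix rings, and one primitive idempotent from each factor
lifts to orthogonal idempotents e_i of R. The class of modules M with Hom(Re_j/Je_j, M) = 0 forces
e_i R e_j = 0 for i ≠ j (`mul_mul_eq_zero_of_torf_subset_serre`). The idempotent e = ∑ e_i is full,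
so R is Morita equivalent to eRe = ∏ e_i R e_i, whose factors are local and artinian. -/

namespace SubcatClasses

/-! ### Inclusions between the kinds of subcategory -/

section Inclusions

variable {A : Type u} [Category.{v} A] [Abelian A]

lemma closedUnderImages_of_quotients (P : ObjectProperty A) [P.IsClosedUnderQuotients] :
    ClosedUnderImages P := fun _ _ f hX _ => P.prop_of_epi (factorThruImage f) hX

lemma closedUnderImages_of_subobjects (P : ObjectProperty A) [P.IsClosedUnderSubobjects] :
    ClosedUnderImages P := fun _ _ f _ hY => P.prop_of_mono (image.ι f) hY

/-- In an abelian category the image is the kernel of the cokernel. -/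
lemma closedUnderImages_of_kernels_cokernels (P : ObjectProperty A) [P.IsClosedUnderKernels]
    [P.IsClosedUnderCokernels] [P.IsClosedUnderIsomorphisms] : ClosedUnderImages P :=
  fun _ _ f hX hY => P.prop_of_iso (Abelian.imageIsoImage f)
    (P.prop_kernel (cokernel.π f) hY (P.prop_cokernel f hX hY))

variable (A)

lemma tors_subset_ie : tors A ⊆ ie A := fun P ⟨h, _, hE⟩ =>
  ⟨h, closedUnderImages_of_quotients P, hE⟩

lemma torf_subset_ie : torf A ⊆ ie A := fun P ⟨h, _, hE⟩ =>
  ⟨h, closedUnderImages_of_subobjects P, hE⟩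

lemma wide_subset_ie : wide A ⊆ ie A := fun P ⟨h, _, _, hE⟩ =>
  have := h.closedUnderIso
  ⟨h, closedUnderImages_of_kernels_cokernels P, hE⟩

lemma ice_subset_ie : ice A ⊆ ie A := fun _ ⟨h, hI, _, hE⟩ => ⟨h, hI, hE⟩

lemma ike_subset_ie : ike A ⊆ ie A := fun _ ⟨h, hI, _, hE⟩ => ⟨h, hI, hE⟩

lemma serre_subset_tors : serre A ⊆ tors A := fun _ ⟨h, _, hQ, hE⟩ => ⟨h, hQ, hE⟩

lemma serre_subset_torf : serre A ⊆ torf A := fun _ ⟨h, hS, _, hE⟩ => ⟨h, hS, hE⟩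

lemma serre_subset_wide : serre A ⊆ wide A := fun _ ⟨h, _, _, hE⟩ =>
  ⟨h, inferInstance, inferInstance, hE⟩

lemma serre_subset_ice : serre A ⊆ ice A := fun P ⟨h, _, _, hE⟩ =>
  ⟨h, closedUnderImages_of_quotients P, inferInstance, hE⟩

lemma serre_subset_ike : serre A ⊆ ike A := fun P ⟨h, _, _, hE⟩ =>
  ⟨h, closedUnderImages_of_quotients P, inferInstance, hE⟩

variable {A}

lemma eq_serre_of_serre_eq_ie (h : serre A = ie A) {C : Set (ObjectProperty A)}
    (h₁ : serre A ⊆ C) (h₂ : C ⊆ ie A) : C = serre A :=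
  (h₂.trans h.ge).antisymm h₁

end Inclusions

/-! ### Finitely generated modules over a noetherian ring, in terms of elements -/

section FiniteModules

variable {R : Type u} [Ring R]

variable [IsNoetherianRing R]

lemma injective_of_mono {X Y : FGModuleCat.{u} R} (f : X ⟶ Y) [Mono f] :
    Function.Injective f.hom.hom :=
  (ModuleCat.mono_iff_injective ((forget₂ (FGModuleCat R) (ModuleCat.{u} R)).map f)).1
    inferInstance

lemma surjective_of_epi {X Y : FGModuleCat.{u} R} (f : X ⟶ Y) [Epi f] :
    Function.Surjective f.hom.hom :=
  (ModuleCat.epi_iff_surjective ((forget₂ (FGModuleCat R) (ModuleCat.{u} R)).map f)).1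
    inferInstance

lemma mono_of_injective {X Y : FGModuleCat.{u} R} (f : X ⟶ Y)
    (hf : Function.Injective f.hom.hom) : Mono f :=
  (forget₂ (FGModuleCat R) (ModuleCat.{u} R)).mono_of_mono_map
    ((ModuleCat.mono_iff_injective _).2 hf)

lemma epi_of_surjective {X Y : FGModuleCat.{u} R} (f : X ⟶ Y)
    (hf : Function.Surjective f.hom.hom) : Epi f :=
  (forget₂ (FGModuleCat R) (ModuleCat.{u} R)).epi_of_epi_map
    ((ModuleCat.epi_iff_surjective _).2 hf)

instance : (forget₂ (FGModuleCat.{u} R) (ModuleCat.{u} R)).Additive where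

lemma exact_of_shortExact {S : ShortComplex (FGModuleCat.{u} R)} (hS : S.ShortExact) :
    Function.Exact S.f.hom.hom S.g.hom.hom :=
  have := hS.mono_f
  have := hS.epi_g
  (ShortComplex.ShortExact.moduleCat_exact_iff_function_exact _).1
    (hS.map (forget₂ (FGModuleCat R) (ModuleCat.{u} R))).exact

/-- The short exact sequence of a submodule of a finitely generated module. -/
noncomputable def submoduleShortComplex (M : FGModuleCat.{u} R) (N : Submodule R M) :
    ShortComplex (FGModuleCat.{u} R) :=
  ShortComplex.mk (X₁ := FGModuleCat.of R N) (X₂ := FGModuleCat.of R M)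
    (X₃ := FGModuleCat.of R (M ⧸ N)) (FGModuleCat.ofHom N.subtype) (FGModuleCat.ofHom N.mkQ)
    (by ext x; exact (Submodule.Quotient.mk_eq_zero N).2 x.2)

lemma submoduleShortComplex_shortExact (M : FGModuleCat.{u} R) (N : Submodule R M) :
    (submoduleShortComplex M N).ShortExact where
  exact := by
    rw [← ShortComplex.exact_map_iff_of_faithful _ (forget₂ (FGModuleCat R) (ModuleCat.{u} R)),
      ShortComplex.ShortExact.moduleCat_exact_iff_function_exact]
    exact LinearMap.exact_subtype_mkQ N
  mono_f := mono_of_injective _ N.subtype_injective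
  epi_g := epi_of_surjective _ N.mkQ_surjective

variable (P : ObjectProperty (FGModuleCat.{u} R))

lemma prop_of_submodule [P.IsClosedUnderExtensions] {M : FGModuleCat.{u} R} (N : Submodule R M)
    (h₁ : P (FGModuleCat.of R N)) (h₂ : P (FGModuleCat.of R (M ⧸ N))) : P M :=
  P.prop_X₂_of_shortExact (submoduleShortComplex_shortExact M N) h₁ h₂

lemma prop_of_surjective [P.IsClosedUnderQuotients] {X Y : FGModuleCat.{u} R}
    (f : X →ₗ[R] Y) (hf : Function.Surjective f) (h : P X) : P Y :=
  have := epi_of_surjective (X := X) (Y := Y) (FGModuleCat.ofHom f) hf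
  P.prop_of_epi (X := X) (Y := Y) (FGModuleCat.ofHom f) h

/-- The image of a composite `X ⟶ S ⟶ Y` of an epimorphism and a monomorphism is `S`. -/
lemma ClosedUnderImages.prop_of_surjective_injective [P.IsClosedUnderIsomorphisms]
    (hP : ClosedUnderImages P) {X S Y : FGModuleCat.{u} R} (f : X →ₗ[R] S) (g : S →ₗ[R] Y)
    (hf : Function.Surjective f) (hg : Function.Injective g) (hX : P X) (hY : P Y) : P S := by
  let f' : X ⟶ S := FGModuleCat.ofHom f
  let g' : S ⟶ Y := FGModuleCat.ofHom g
  have : Epi f' := epi_of_surjective f' hf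
  have : Mono g' := mono_of_injective g' hg
  have : StrongEpi f' := strongEpi_of_epi f'
  exact P.prop_of_iso (image.isoStrongEpiMono f' g' (rfl : f' ≫ g' = f' ≫ g')).symm (hP _ hX hY)

/-- A class of finitely generated modules closed under submodules and extensions is a torsion-free
class. -/
lemma mem_torf {P : ObjectProperty (FGModuleCat.{u} R)}
    (zero : P (FGModuleCat.of R PUnit))
    (sub : ∀ (X Y : FGModuleCat.{u} R) (f : X →ₗ[R] Y), Function.Injective f → P Y → P X)
    (ext : ∀ (X Y Z : FGModuleCat.{u} R) (f : X →ₗ[R] Y) (g : Y →ₗ[R] Z), Function.Injective f →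
      Function.Exact f g → P X → P Z → P Y) :
    P ∈ torf (FGModuleCat.{u} R) := by
  have hS : P.IsClosedUnderSubobjects := ⟨fun f _ h => sub _ _ f.hom.hom (injective_of_mono f) h⟩
  have hE : P.IsClosedUnderExtensions := ⟨fun {S} hS h₁ h₃ =>
    have := hS.mono_f
    ext _ _ _ S.f.hom.hom S.g.hom.hom (injective_of_mono S.f) (exact_of_shortExact hS) h₁ h₃⟩
  refine ⟨⟨⟨_, ?_, zero⟩, inferInstance, fun X Y hX hY => P.prop_biprod hX hY⟩, hS, hE⟩
  rw [IsZero.iff_id_eq_zero]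
  ext x

end FiniteModules

end SubcatClasses

/-- Additive maps respect integer multiples for every ℤ-module structure, so the two linear
structures may be arbitrary. -/
lemma CategoryTheory.Functor.linear_int_of_additive {C D : Type*} [Category* C] [Category* D]
    [Preadditive C] [Preadditive D] (h : CategoryTheory.Linear ℤ C) (h' : CategoryTheory.Linear ℤ D)
    (F : C ⥤ D) [F.Additive] : @Functor.Linear ℤ _ C D _ _ _ _ h h' F :=
  @Functor.Linear.mk ℤ _ C D _ _ _ _ h h' F fun {X Y} f r => by
    have := @map_intCast_smul _ _ _ _ _ _ _ (F.mapAddHom (X := X) (Y := Y)) ℤ ℤ _ _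
      (h.homModule X Y) (h'.homModule _ _) r f
    rwa [Int.cast_id] at this

/-! ### Morita equivalence of R with eRe for a full idempotent e -/

namespace IsIdempotentElem

section Fixed

variable {R : Type*} [Ring R] {e : R} (he : IsIdempotentElem e)

lemma Corner.mul_val (c : he.Corner) : e * c.1 = c.1 :=
  ((Subsemigroup.mem_corner_iff he).1 c.2).1

lemma Corner.val_mul (c : he.Corner) : c.1 * e = c.1 :=
  ((Subsemigroup.mem_corner_iff he).1 c.2).2

@[ext] lemma Corner.ext {c d : he.Corner} (h : c.1 = d.1) : c = d := Subtype.ext h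

@[simp] lemma Corner.val_one : (1 : he.Corner).1 = e := rfl
@[simp] lemma Corner.val_zero : (0 : he.Corner).1 = 0 := rfl
@[simp] lemma Corner.val_add (c d : he.Corner) : (c + d).1 = c.1 + d.1 := rfl
@[simp] lemma Corner.val_mul_val (c d : he.Corner) : (c * d).1 = c.1 * d.1 := rfl

/-- The element `e * r * e` of the corner of `e`. -/
def toCorner (r : R) : he.Corner := ⟨e * r * e, r, rfl⟩

@[simp] lemma toCorner_val (r : R) : (he.toCorner r).1 = e * r * e := rfl

/-- The additive group `eM` of a module `M`, for an idempotent `e`. -/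
def Fixed (_ : IsIdempotentElem e) (M : Type*) [AddCommGroup M] [Module R M] : Type _ :=
  {m : M // e • m = m}

variable (M : Type*) [AddCommGroup M] [Module R M]

/-- The subgroup `eM` of a module `M`. -/
def fixedSubgroup : AddSubgroup M where
  carrier := {m | e • m = m}
  zero_mem' := smul_zero e
  add_mem' {a b} ha hb := by
    rw [Set.mem_ofPred_eq] at *
    rw [smul_add, ha, hb]
  neg_mem' {a} ha := by
    rw [Set.mem_ofPred_eq] at *
    rw [smul_neg, ha]

instance : AddCommGroup (he.Fixed M) := inferInstanceAs (AddCommGroup (fixedSubgroup (e := e) M))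

variable {M}

lemma Fixed.smul_val (m : he.Fixed M) : e • m.1 = m.1 := m.2

@[ext] lemma Fixed.ext {m n : he.Fixed M} (h : m.1 = n.1) : m = n := Subtype.ext h

@[simp] lemma Fixed.val_add (m n : he.Fixed M) : (m + n).1 = m.1 + n.1 := rfl
@[simp] lemma Fixed.val_zero : (0 : he.Fixed M).1 = 0 := rfl

instance : Module he.Corner (he.Fixed M) where
  smul c m := ⟨c.1 • m.1, by rw [smul_smul, Corner.mul_val]⟩
  one_smul m := Fixed.ext he m.2
  mul_smul c d m := Fixed.ext he (mul_smul c.1 d.1 m.1)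
  smul_zero c := Fixed.ext he (smul_zero c.1)
  smul_add c m n := Fixed.ext he (smul_add c.1 m.1 n.1)
  add_smul c d m := Fixed.ext he (add_smul c.1 d.1 m.1)
  zero_smul m := Fixed.ext he (zero_smul R m.1)

@[simp] lemma Fixed.val_smul (c : he.Corner) (m : he.Fixed M) : (c • m).1 = c.1 • m.1 := rfl

/-- The element `e • m` of `eM`. -/
def toFixed (m : M) : he.Fixed M := ⟨e • m, by rw [smul_smul, he.eq]⟩

@[simp] lemma toFixed_val (m : M) : (he.toFixed m).1 = e • m := rfl

/-- The map `eM → eN` induced by a linear map `M → N`. -/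
def fixedMap {N : Type*} [AddCommGroup N] [Module R N] (f : M →ₗ[R] N) :
    he.Fixed M →ₗ[he.Corner] he.Fixed N where
  toFun m := ⟨f m.1, by rw [← f.map_smul, m.2]⟩
  map_add' m n := Fixed.ext he (f.map_add m.1 n.1)
  map_smul' c m := Fixed.ext he (f.map_smul c.1 m.1)

/-- The `R`-module coinduced by a module over the corner of `e`. -/
def Coind (N : Type*) [AddCommGroup N] [Module he.Corner N] : Type _ :=
  he.Fixed R →ₗ[he.Corner] N

/-- Right multiplication on `eR`. -/
def fixedMulRight (r : R) : he.Fixed R →ₗ[he.Corner] he.Fixed R where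
  toFun x := ⟨x.1 * r, by rw [smul_eq_mul, ← mul_assoc]; exact congrArg (· * r) x.2⟩
  map_add' x y := Fixed.ext he (add_mul _ _ _)
  map_smul' c x := Fixed.ext he (mul_assoc _ _ _)

@[simp] lemma fixedMulRight_val (r : R) (x : he.Fixed R) :
    (he.fixedMulRight r x).1 = x.1 * r := rfl

variable (N : Type*) [AddCommGroup N] [Module he.Corner N]

instance : AddCommGroup (he.Coind N) := inferInstanceAs (AddCommGroup (he.Fixed R →ₗ[he.Corner] N))

instance : FunLike (he.Coind N) (he.Fixed R) N :=
  inferInstanceAs (FunLike (he.Fixed R →ₗ[he.Corner] N) (he.Fixed R) N)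

instance : LinearMapClass (he.Coind N) he.Corner (he.Fixed R) N :=
  inferInstanceAs (LinearMapClass (he.Fixed R →ₗ[he.Corner] N) he.Corner (he.Fixed R) N)

variable {N}

lemma Coind.ext {φ ψ : he.Coind N} (h : ∀ x, φ x = ψ x) : φ = ψ := DFunLike.ext φ ψ h

instance : SMul R (he.Coind N) where
  smul r φ := LinearMap.comp (show he.Fixed R →ₗ[he.Corner] N from φ) (he.fixedMulRight r)

lemma Coind.smul_apply (r : R) (φ : he.Coind N) (x : he.Fixed R) :
    (r • φ) x = φ (he.fixedMulRight r x) := rfl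

lemma Coind.add_apply (φ ψ : he.Coind N) (x : he.Fixed R) : (φ + ψ) x = φ x + ψ x := rfl

lemma Coind.zero_apply (x : he.Fixed R) : (0 : he.Coind N) x = 0 := rfl

instance : Module R (he.Coind N) where
  one_smul φ := Coind.ext he fun x => congrArg φ (Fixed.ext he (mul_one _))
  mul_smul r s φ := Coind.ext he fun x => congrArg φ (Fixed.ext he (mul_assoc _ _ _).symm)
  smul_zero r := rfl
  smul_add r φ ψ := rfl
  add_smul r s φ := Coind.ext he fun x => by
    rw [Coind.add_apply, Coind.smul_apply, Coind.smul_apply, Coind.smul_apply, ← map_add]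
    exact congrArg φ (Fixed.ext he (mul_add _ _ _))
  zero_smul φ := Coind.ext he fun x => by
    rw [Coind.zero_apply, Coind.smul_apply, ← map_zero φ]
    exact congrArg φ (Fixed.ext he (mul_zero _))

variable (N)

/-- The corner functor is a left inverse of coinduction. -/
def fixedCoindEquiv : he.Fixed (he.Coind N) ≃ₗ[he.Corner] N where
  -- Evaluation at e. The inverse sends n to x ↦ (xe)n, where xe lies in eRe because x is in eR.
  toFun φ := φ.1 (he.toFixed 1)
  map_add' φ ψ := rfl
  map_smul' c φ := by
    rw [RingHom.id_apply, ← map_smul φ.1, Fixed.val_smul, Coind.smul_apply]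
    refine congrArg φ.1 (Fixed.ext he ?_)
    simp [Corner.mul_val, Corner.val_mul]
  invFun n := ⟨show he.Fixed R →ₗ[he.Corner] N from
    { toFun := fun x => he.toCorner x.1 • n
      map_add' := fun x y => by
        rw [← add_smul]
        exact congrArg (· • n) (Corner.ext he (by simp [mul_add, add_mul]))
      map_smul' := fun c x => by
        rw [RingHom.id_apply, smul_smul]
        refine congrArg (· • n) (Corner.ext he ?_)
        have := Fixed.smul_val he x
        rw [smul_eq_mul] at this
        simp only [toCorner_val, Fixed.val_smul, smul_eq_mul, Corner.val_mul_val]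
        rw [this, ← mul_assoc, Corner.mul_val, ← mul_assoc] },
    Coind.ext he fun x => by
      refine congrArg (· • n) (Corner.ext he ?_)
      simp [mul_assoc, he.eq]⟩
  left_inv φ := by
    refine Fixed.ext he (Coind.ext he fun x => ?_)
    change he.toCorner x.1 • φ.1 (he.toFixed 1) = φ.1 x
    conv_rhs => rw [← φ.2]
    rw [← map_smul φ.1, Coind.smul_apply]
    refine congrArg φ.1 (Fixed.ext he ?_)
    have := Fixed.smul_val he x
    rw [smul_eq_mul] at this
    simp only [Fixed.val_smul, toCorner_val, toFixed_val, smul_eq_mul, mul_one,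
      fixedMulRight_val, mul_assoc, he.eq]
    rw [← mul_assoc, this]
  right_inv n := by
    change he.toCorner (he.toFixed (1 : R)).1 • n = n
    conv_rhs => rw [← one_smul he.Corner n]
    exact congrArg (· • n) (Corner.ext he (by simp [he.eq]))

end Fixed

section Full

variable {R : Type*} [Ring R] {e : R} (he : IsIdempotentElem e)
  {M N : Type*} [AddCommGroup M] [Module R M] [AddCommGroup N] [Module R N]
  {ι : Type*} [Fintype ι] {a b : ι → R}

lemma sum_smul_eq (h : ∑ i, a i * e * b i = 1) (m : M) : ∑ i, a i • e • b i • m = m := by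
  simp_rw [smul_smul, ← Finset.sum_smul, ← mul_assoc, h, one_smul]

lemma fixedMap_injective (h : ∑ i, a i * e * b i = 1) :
    Function.Injective (he.fixedMap : (M →ₗ[R] N) → _) := by
  intro f g hfg
  ext m
  rw [← sum_smul_eq h m, map_sum, map_sum]
  refine Finset.sum_congr rfl fun i _ => ?_
  rw [f.map_smul, g.map_smul]
  exact congrArg (a i • ·) (congrArg Subtype.val (LinearMap.congr_fun hfg (he.toFixed (b i • m))))

lemma fixedMap_surjective (h : ∑ i, a i * e * b i = 1) :
    Function.Surjective (he.fixedMap : (M →ₗ[R] N) → _) := by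
  intro f
  -- Inserting 1 = ∑ a_j e b_j gives e r m = ∑ (e r a_j e)(e b_j m), with coefficients in eRe that
  -- pass through f.
  have key (r : R) (m : M) : (f (he.toFixed (r • m))).1 =
      ∑ j, (e * r * a j) • (f (he.toFixed (b j • m))).1 := by
    have : he.toFixed (r • m) = ∑ j, he.toCorner (r * a j) • he.toFixed (b j • m) := by
      refine Fixed.ext he ?_
      rw [show (∑ j, he.toCorner (r * a j) • he.toFixed (b j • m)).1 =
        ∑ j, (he.toCorner (r * a j) • he.toFixed (b j • m)).1 from
        map_sum (fixedSubgroup (e := e) M).subtype _ _]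
      conv_lhs => rw [← sum_smul_eq h m]
      simp only [toFixed_val, Finset.smul_sum, Fixed.val_smul, toCorner_val, smul_smul]
      refine Finset.sum_congr rfl fun j _ => ?_
      simp only [mul_assoc]
      rw [← mul_assoc e e, he.eq]
    rw [this, map_sum]
    rw [show (∑ j, f (he.toCorner (r * a j) • he.toFixed (b j • m))).1 =
        ∑ j, (f (he.toCorner (r * a j) • he.toFixed (b j • m))).1 from
        map_sum (fixedSubgroup (e := e) N).subtype _ _]
    refine Finset.sum_congr rfl fun j _ => ?_
    rw [map_smul, Fixed.val_smul, toCorner_val, mul_smul, Fixed.smul_val, mul_assoc]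
  -- The preimage is forced by m = ∑ a_i e b_i m.
  refine ⟨
    { toFun := fun m => ∑ i, a i • (f (he.toFixed (b i • m))).1
      map_add' := fun m n => ?_
      map_smul' := fun r m => ?_ }, ?_⟩
  · rw [← Finset.sum_add_distrib]
    refine Finset.sum_congr rfl fun i _ => ?_
    rw [← smul_add, ← Fixed.val_add, ← map_add]
    refine congrArg (fun x => a i • (f x).1) (Fixed.ext he ?_)
    simp
  · simp only [smul_smul _ r m, key (_ * r) m, Finset.smul_sum, RingHom.id_apply]
    rw [Finset.sum_comm]
    refine Finset.sum_congr rfl fun j _ => ?_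
    simp only [smul_smul]
    rw [← Finset.sum_smul]
    congr 1
    simp only [← mul_assoc]
    rw [← Finset.sum_mul, ← Finset.sum_mul, h, one_mul]
  · refine LinearMap.ext fun m => Fixed.ext he ?_
    change ∑ i, a i • (f (he.toFixed (b i • m.1))).1 = (f m).1
    have := sum_smul_eq h (f m).1
    conv_rhs => rw [← this]
    refine Finset.sum_congr rfl fun i _ => congrArg (a i • ·) ?_
    have : he.toFixed (b i • m.1) = he.toCorner (b i) • m := by
      refine Fixed.ext he ?_
      simp only [toFixed_val, Fixed.val_smul, toCorner_val, mul_smul, Fixed.smul_val]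
    rw [this, map_smul, Fixed.val_smul, toCorner_val, mul_smul, mul_smul, Fixed.smul_val]

end Full

section Morita

variable {R : Type u} [Ring R] {e : R} (he : IsIdempotentElem e)

/-- The functor `M ↦ eM` from `R`-modules to modules over the corner of `e`. -/
def cornerFunctor : ModuleCat.{u} R ⥤ ModuleCat.{u} he.Corner where
  obj M := ModuleCat.of he.Corner (he.Fixed M)
  map f := ModuleCat.ofHom (he.fixedMap f.hom)

instance : he.cornerFunctor.Additive where

instance : he.cornerFunctor.EssSurj where
  mem_essImage N := ⟨ModuleCat.of R (he.Coind N), ⟨(he.fixedCoindEquiv N).toModuleIso⟩⟩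

/-- A ring is Morita equivalent to the corner of a full idempotent. -/
theorem isMoritaEquivalent_corner {ι : Type*} [Fintype ι] {a b : ι → R}
    (h : ∑ i, a i * e * b i = 1) : IsMoritaEquivalent ℤ R he.Corner := by
  have : he.cornerFunctor.Faithful :=
    ⟨fun {X Y} f g hfg => ModuleCat.hom_ext (he.fixedMap_injective h (ModuleCat.hom_ext_iff.1 hfg))⟩
  have : he.cornerFunctor.Full := ⟨fun {X Y} f => by
    obtain ⟨g, hg⟩ := he.fixedMap_surjective (M := X) (N := Y) h f.hom
    exact ⟨ModuleCat.ofHom g, ModuleCat.hom_ext hg⟩⟩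
  have : he.cornerFunctor.IsEquivalence := {}
  exact ⟨⟨{ eqv := he.cornerFunctor.asEquivalence
            linear := have : he.cornerFunctor.asEquivalence.functor.Additive :=
              inferInstanceAs he.cornerFunctor.Additive
            Functor.linear_int_of_additive _ _ _ }⟩⟩

end Morita

end IsIdempotentElem

/-! ### Nilpotent elements and the artinian condition in corners -/

namespace IsIdempotentElem

variable {R : Type*} [Ring R] {e : R} (he : IsIdempotentElem e)

lemma toCorner_val_eq (c : he.Corner) : he.toCorner c.1 = c :=
  Corner.ext he (by rw [toCorner_val, Corner.mul_val, Corner.val_mul])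

lemma isNilpotent_of_isNilpotent_val {c : he.Corner} (h : IsNilpotent c.1) : IsNilpotent c := by
  obtain ⟨n, hn⟩ := h
  -- The exponent is shifted because zeroth powers differ: the unit of the corner is e.
  have key (k : ℕ) : (c ^ (k + 1)).1 = c.1 ^ (k + 1) := by
    induction k with
    | zero => simp
    | succ k ih => rw [pow_succ, Corner.val_mul_val, ih, ← pow_succ]
  exact ⟨n + 1, Corner.ext he (by rw [key, pow_succ, hn, zero_mul, Corner.val_zero])⟩

/-- The map I ↦ RI from left ideals of eRe to left ideals of R is strictly monotone, because I is
recovered as RI ∩ eRe. -/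
lemma isArtinianRing_corner [IsArtinianRing R] : IsArtinianRing he.Corner := by
  let F : Ideal he.Corner → Ideal R := fun I => Ideal.span (Subtype.val '' (I : Set he.Corner))
  have hF (I : Ideal he.Corner) {c : he.Corner} (hc : c.1 ∈ F I) : c ∈ I := by
    -- The free factor r absorbs the scalars that occur in the span induction.
    have key : ∀ x ∈ F I, ∀ r, he.toCorner (r * x) ∈ I := by
      intro x hx
      induction hx using Submodule.span_induction with
      | mem x hx =>
        obtain ⟨d, hd, rfl⟩ : ∃ d : he.Corner, d ∈ I ∧ d.1 = x := hx
        intro r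
        have : he.toCorner (r * d.1) = he.toCorner r * d := Corner.ext he (by
          simp only [toCorner_val, Corner.val_mul_val, mul_assoc, Corner.val_mul, Corner.mul_val])
        rw [this]
        exact I.mul_mem_left _ hd
      | zero =>
        intro r
        have : he.toCorner (r * 0) = 0 := Corner.ext he (by simp)
        rw [this]
        exact I.zero_mem
      | add x y _ _ hx hy =>
        intro r
        have : he.toCorner (r * (x + y)) = he.toCorner (r * x) + he.toCorner (r * y) :=
          Corner.ext he (by simp [mul_add, add_mul])
        rw [this]
        exact I.add_mem (hx r) (hy r)
      | smul s x _ hx =>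
        intro r
        rw [smul_eq_mul, ← mul_assoc]
        exact hx (r * s)
    rw [← he.toCorner_val_eq c, ← one_mul c.1]
    exact key _ hc 1
  have hmono : StrictMono F := by
    intro I I' h
    refine lt_of_le_not_ge (Ideal.span_mono (Set.image_mono h.le)) fun h' => h.not_ge fun c hc => ?_
    exact hF I (h' (Ideal.subset_span ⟨c, hc, rfl⟩))
  exact hmono.wellFoundedLT

end IsIdempotentElem

/-! ### Corner of a sum of orthogonal idempotents -/

namespace OrthogonalIdempotents

variable {R : Type*} [Ring R] {ι : Type*} [Fintype ι] {e : ι → R} (he : OrthogonalIdempotents e)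

/-- The corner of a sum of orthogonal idempotents `e i` with `e i * r * e j = 0` for `i ≠ j` is the
product of the corners of the idempotents. -/
def cornerSumRingEquiv (h : ∀ i j, i ≠ j → ∀ r, e i * r * e j = 0) :
    he.isIdempotentElem_sum (s := Finset.univ).Corner ≃+* Π i, (he.idem i).Corner where
  toFun c i := (he.idem i).toCorner c.1
  invFun x := he.isIdempotentElem_sum.toCorner (∑ i, (x i).1)
  left_inv c := by
    refine IsIdempotentElem.Corner.ext _ ?_
    have : ∑ i, e i * c.1 * e i = c.1 := by
      conv_rhs => rw [← IsIdempotentElem.Corner.val_mul _ c, ← IsIdempotentElem.Corner.mul_val _ c,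
        Finset.sum_mul, Finset.sum_mul]
      refine Finset.sum_congr rfl fun i _ => ?_
      rw [Finset.mul_sum, Finset.sum_eq_single i (fun j _ hj => h i j hj.symm _) (by simp)]
    simp only [IsIdempotentElem.toCorner_val, this]
    rw [IsIdempotentElem.Corner.mul_val, IsIdempotentElem.Corner.val_mul]
  right_inv x := by
    classical
    funext i
    refine IsIdempotentElem.Corner.ext _ ?_
    have hs : e i * ∑ j, e j = e i := by
      rw [he.mul_sum_of_mem (Finset.mem_univ i)]
    have hs' : (∑ j, e j) * e i = e i := by
      rw [Finset.sum_mul, Finset.sum_eq_single i (fun j _ hj => he.ortho hj) (by simp), he.idem i]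
    simp only [IsIdempotentElem.toCorner_val]
    rw [← mul_assoc, ← mul_assoc, hs, mul_assoc, hs', Finset.mul_sum, Finset.sum_mul,
      Finset.sum_eq_single i (fun j _ hj => ?_) (by simp), IsIdempotentElem.Corner.mul_val,
      IsIdempotentElem.Corner.val_mul]
    rw [← IsIdempotentElem.Corner.mul_val _ (x j), ← mul_assoc, he.ortho hj.symm, zero_mul, zero_mul]
  map_add' c d := by
    funext i
    exact IsIdempotentElem.Corner.ext _ (by simp [mul_add, add_mul])
  map_mul' c d := by
    funext i
    refine IsIdempotentElem.Corner.ext _ ?_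
    simp only [IsIdempotentElem.toCorner_val, IsIdempotentElem.Corner.val_mul_val, Pi.mul_apply]
    conv_lhs => rw [← IsIdempotentElem.Corner.mul_val _ d]
    rw [Finset.sum_mul, Finset.mul_sum, Finset.mul_sum, Finset.sum_mul,
      Finset.sum_eq_single i (fun j _ hj => ?_) (by simp)]
    · simp only [mul_assoc]
      rw [← mul_assoc (e i) (e i), he.idem i]
    · rw [← mul_assoc, ← mul_assoc, h i j hj.symm, zero_mul, zero_mul]

end OrthogonalIdempotents

/-! ### Primitive idempotents in a product of matrix rings -/

section Matrix

variable {ι : Type*} [DecidableEq ι] {d : ι → ℕ} [∀ i, NeZero (d i)] (D : ι → Type*)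
  [∀ i, DivisionRing (D i)]

/-- The upper left matrix unit of each factor of a product of matrix rings. -/
def matrixCornerIdempotent (i : ι) : Π i, Matrix (Fin (d i)) (Fin (d i)) (D i) :=
  Pi.single i (Matrix.single 0 0 1)

lemma matrixCornerIdempotent_orthogonal :
    OrthogonalIdempotents (matrixCornerIdempotent D (d := d)) where
  idem i := by simp [IsIdempotentElem, matrixCornerIdempotent, ← Pi.single_mul]
  ortho i j hij := by
    funext k
    rcases eq_or_ne k i with rfl | h
    · simp [matrixCornerIdempotent, hij]
    · simp [matrixCornerIdempotent, h]

lemma matrixCornerIdempotent_mul_mul {i j : ι} (hij : i ≠ j)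
    (s : Π i, Matrix (Fin (d i)) (Fin (d i)) (D i)) :
    matrixCornerIdempotent D i * s * matrixCornerIdempotent D j = 0 := by
  funext k
  rcases eq_or_ne k i with rfl | h
  · simp [matrixCornerIdempotent, hij]
  · simp [matrixCornerIdempotent, h]

lemma matrixCornerIdempotent_ne_zero (i : ι) : matrixCornerIdempotent D (d := d) i ≠ 0 := by
  intro h
  have := congrFun (congrFun (congrFun h i) 0) 0
  simp [matrixCornerIdempotent] at this

/-- The corner at the idempotent is a copy of the division ring D_i: s is determined by its upper
left entry in the factor i. -/
lemma exists_inverse_of_matrixCornerIdempotent_mul_mul_ne_zero {i : ι}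
    {s : Π i, Matrix (Fin (d i)) (Fin (d i)) (D i)}
    (hs : matrixCornerIdempotent D i * s * matrixCornerIdempotent D i = s) (h : s ≠ 0) :
    ∃ t, t * s = matrixCornerIdempotent D i ∧ s * t = matrixCornerIdempotent D i := by
  have key : s = Pi.single i (Matrix.single 0 0 (s i 0 0)) := by
    conv_lhs => rw [← hs]
    funext k
    rcases eq_or_ne k i with rfl | h
    · simp [matrixCornerIdempotent]
    · simp [matrixCornerIdempotent, h]
  have h0 : s i 0 0 ≠ 0 := by
    intro h0
    rw [h0] at key
    exact h (by simpa using key)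
  refine ⟨Pi.single i (Matrix.single 0 0 (s i 0 0)⁻¹), ?_, ?_⟩
  · rw [key]
    simp [← Pi.single_mul, h0, matrixCornerIdempotent]
  · rw [key]
    simp [← Pi.single_mul, h0, matrixCornerIdempotent]

/-- The sum of the chosen idempotents is full: in each factor E_kk = E_k0 E_00 E_0k, and the E_kk
add up to 1. -/
lemma exists_sum_mul_matrixCornerIdempotent_mul_eq_one [Fintype ι] :
    ∃ a b : (Σ i, Fin (d i)) → Π i, Matrix (Fin (d i)) (Fin (d i)) (D i),
      ∑ k, a k * (∑ i, matrixCornerIdempotent D i) * b k = 1 := by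
  refine ⟨fun k => Pi.single k.1 (Matrix.single k.2 0 1),
    fun k => Pi.single k.1 (Matrix.single 0 k.2 1), ?_⟩
  have key (k : Σ i, Fin (d i)) : (Pi.single k.1 (Matrix.single k.2 0 1) :
      Π i, Matrix (Fin (d i)) (Fin (d i)) (D i)) * (∑ i, matrixCornerIdempotent D i) *
      Pi.single k.1 (Matrix.single 0 k.2 1) = Pi.single k.1 (Matrix.single k.2 k.2 1) := by
    rw [Finset.mul_sum, Finset.sum_mul, Finset.sum_eq_single k.1 (fun j _ hj => ?_) (by simp)]
    · simp [matrixCornerIdempotent, ← Pi.single_mul]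
    · funext l
      rcases eq_or_ne l j with rfl | h
      · simp [matrixCornerIdempotent, hj]
      · simp [matrixCornerIdempotent, h]
  simp only [key, Fintype.sum_sigma]
  have (i : ι) : ∑ x : Fin (d i), (Pi.single i (Matrix.single x x 1) :
      Π i, Matrix (Fin (d i)) (Fin (d i)) (D i)) = Pi.single i 1 := by
    rw [← Matrix.sum_single_one]
    exact (map_sum (AddMonoidHom.single
      (fun i => Matrix (Fin (d i)) (Fin (d i)) (D i)) i) _ _).symm
  simp only [this]
  exact Finset.univ_sum_single (1 : Π i, Matrix (Fin (d i)) (Fin (d i)) (D i))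

end Matrix

/-- An artinian ring is an extension of a product of matrix rings over division rings by a nil
ideal. -/
lemma IsArtinianRing.exists_ringHom_pi_matrix (R : Type u) [Ring R] [IsArtinianRing R] :
    ∃ (n : ℕ) (D : Fin n → Type u) (d : Fin n → ℕ) (_ : ∀ i, DivisionRing (D i))
      (_ : ∀ i, NeZero (d i)) (f : R →+* Π i, Matrix (Fin (d i)) (Fin (d i)) (D i)),
      Function.Surjective f ∧ ∀ x ∈ RingHom.ker f, IsNilpotent x := by
  obtain ⟨n, D, d, hD, hd, ⟨g⟩⟩ :=
    IsSemisimpleRing.exists_ringEquiv_pi_matrix_divisionRing (R ⧸ Ring.jacobson R)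
  refine ⟨n, D, d, hD, hd, g.toRingHom.comp (Ideal.Quotient.mk (Ring.jacobson R)),
    g.surjective.comp Ideal.Quotient.mk_surjective, fun x hx => ?_⟩
  have hx' : x ∈ Ring.jacobson R := by
    rw [RingHom.mem_ker] at hx
    exact Ideal.Quotient.eq_zero_iff_mem.1 (g.map_eq_zero_iff.1 hx)
  obtain ⟨m, hm⟩ := IsSemiprimaryRing.isNilpotent (R := R)
  have := Ideal.pow_mem_pow hx' m
  rw [hm] at this
  exact ⟨m, this⟩

/-! ### From torsion-free classes to a product of artinian local rings -/

namespace SubcatClasses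

variable {R : Type u} [Ring R] [IsNoetherianRing R]

/-- Torsion-free classes that are Serre subcategories are closed under quotients. -/
lemma prop_quotient_of_torf_subset_serre (h : torf (FGModuleCat.{u} R) ⊆ serre (FGModuleCat.{u} R))
    {P : ObjectProperty (FGModuleCat.{u} R)} (hP : P ∈ torf (FGModuleCat.{u} R))
    {L L' : Ideal R} (hL : L ≤ L') (hPL : P (FGModuleCat.of R (R ⧸ L))) :
    P (FGModuleCat.of R (R ⧸ L')) :=
  have := (h hP).2.2.1
  prop_of_surjective P (X := FGModuleCat.of R (R ⧸ L)) (Y := FGModuleCat.of R (R ⧸ L'))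
    (Submodule.factor hL) (Submodule.factor_surjective hL) hPL

/-- For L maximal among the artinian left ideals, R/L has no nonzero artinian submodule. If L were
proper, a simple quotient of R/L would have none either, which is absurd. -/
lemma isArtinianRing_of_torf_subset_serre
    (h : torf (FGModuleCat.{u} R) ⊆ serre (FGModuleCat.{u} R)) : IsArtinianRing R := by
  let P : ObjectProperty (FGModuleCat.{u} R) := fun M =>
    ∀ N : Submodule R M, IsArtinian R N → N = ⊥
  have hP : P ∈ torf (FGModuleCat.{u} R) := by
    refine mem_torf (fun N _ => ?_) (fun X Y f hf hY N _ => ?_) fun X Y Z f g hf hfg hX hZ N _ => ?_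
    · rw [Submodule.eq_bot_iff]
      exact fun x _ => Subsingleton.elim (α := PUnit) _ _
    · have := hY (N.map f) (isArtinian_of_surjective N (f.submoduleMap N)
        (f.submoduleMap_surjective N))
      rw [← Submodule.comap_map_eq_of_injective hf N, this, Submodule.comap_bot,
        LinearMap.ker_eq_bot.2 hf]
    -- An artinian submodule of Y has zero image in Z, so it comes from X.
    · have h1 := hZ (N.map g) (isArtinian_of_surjective N (g.submoduleMap N)
        (g.submoduleMap_surjective N))
      have h2 : N ≤ LinearMap.range f := by
        rw [← LinearMap.exact_iff.1 hfg]
        exact LinearMap.le_ker_iff_map.2 h1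
      have h3 := hX (N.comap f) (isArtinian_of_injective
        (f.restrict (p := N.comap f) (q := N) fun _ hx => hx)
        fun x y hxy => Subtype.ext (hf (congrArg Subtype.val hxy)))
      rw [← Submodule.map_comap_eq_of_le h2, h3, Submodule.map_bot]
  obtain ⟨L, hL, hmax⟩ := set_has_maximal_iff_noetherian.2 (inferInstanceAs (IsNoetherian R R))
    {L : Ideal R | IsArtinian R L} ⟨⊥, inferInstanceAs (IsArtinian R (⊥ : Ideal R))⟩
  have hPL : P (FGModuleCat.of R (R ⧸ L)) := by
    intro N hN
    let N' : Ideal R := N.comap L.mkQ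
    have hLN : L ≤ N' := by
      intro x hx
      change L.mkQ x ∈ N
      rw [Submodule.mkQ_apply, (Submodule.Quotient.mk_eq_zero L).2 hx]
      exact N.zero_mem
    -- The preimage of N is an extension of N by L.
    have hart : IsArtinian R N' := by
      have : IsArtinian R L := hL
      refine isArtinian_of_range_eq_ker (Submodule.inclusion hLN)
        (L.mkQ.restrict (p := N') (q := N) fun _ hx => hx) ?_
      ext x
      rw [LinearMap.mem_ker, LinearMap.mem_range]
      constructor
      · rintro ⟨y, rfl⟩
        exact Subtype.ext ((Submodule.Quotient.mk_eq_zero L).2 y.2)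
      · exact fun hx => ⟨⟨x.1, (Submodule.Quotient.mk_eq_zero L).1 (congrArg Subtype.val hx)⟩, rfl⟩
    have : ¬ L < N' := hmax N' hart
    have : N' = L := (hLN.eq_of_not_lt this).symm
    rw [← Submodule.map_comap_eq_of_surjective L.mkQ_surjective N]
    change Submodule.map L.mkQ N' = ⊥
    rw [this, Submodule.mkQ_map_self]
  have htop : L = ⊤ := by
    by_contra hne
    obtain ⟨m, hm, hLm⟩ := Ideal.exists_le_maximal L hne
    have := prop_quotient_of_torf_subset_serre h hP hLm hPL
    have hs : IsSimpleModule R (R ⧸ m) := isSimpleModule_iff_isCoatom.2 hm.out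
    have h0 := this ⊤ (inferInstanceAs (IsArtinian R (⊤ : Submodule R (R ⧸ m))))
    have := IsSimpleModule.nontrivial R (R ⧸ m)
    exact top_ne_bot (α := Submodule R (R ⧸ m)) h0
  rw [htop] at hL
  have : IsArtinian R (⊤ : Ideal R) := hL
  exact isArtinian_of_surjective (⊤ : Ideal R) (Submodule.topEquiv (R := R) (M := R)).toLinearMap
    (Submodule.topEquiv (R := R) (M := R)).surjective

/-- With J = ker f and L = {x | eRxe' = 0}, the quotient R/L is torsion-free for the class
Hom(Re'/Je', -) = 0, hence so is R/(L + J). There the class of 1 is fixed by e' and killed by J, so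
L + J = R; as J is nil, L = R. -/
lemma mul_mul_eq_zero_of_torf_subset_serre
    (h : torf (FGModuleCat.{u} R) ⊆ serre (FGModuleCat.{u} R)) {S : Type*} [Ring S] (f : R →+* S)
    (hf : ∀ x ∈ RingHom.ker f, IsNilpotent x) {e e' : R} (he : IsIdempotentElem e)
    (he' : IsIdempotentElem e')
    (hee' : ∀ r, f (e * r * e') = 0) (r : R) : e * r * e' = 0 := by
  let P : ObjectProperty (FGModuleCat.{u} R) := fun M =>
    ∀ x : M, e' • x = x → (∀ a ∈ RingHom.ker f, a • x = 0) → x = 0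
  have hP : P ∈ torf (FGModuleCat.{u} R) := by
    refine mem_torf (fun x _ _ => Subsingleton.elim (α := PUnit) _ _)
      (fun X Y i hi hY x hx hx' => ?_) fun X Y Z i p hi hip hX hZ y hy hy' => ?_
    · refine hi (Eq.trans (hY (i x) ?_ fun a ha => ?_) i.map_zero.symm)
      · rw [← i.map_smul, hx]
      · rw [← i.map_smul, hx' a ha, i.map_zero]
    · have h0 : p y = 0 := hZ (p y) (by rw [← p.map_smul, hy])
        fun a ha => by rw [← p.map_smul, hy' a ha, p.map_zero]
      obtain ⟨x, rfl⟩ := (hip y).1 h0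
      have : x = 0 := hX x (hi (by rw [i.map_smul, hy])) fun a ha =>
        hi (by rw [i.map_smul, hy' a ha, i.map_zero])
      rw [this, i.map_zero]
  let L : Ideal R :=
    { carrier := {x | ∀ s, e * s * x * e' = 0}
      add_mem' := fun {a b} ha hb s => by rw [mul_add, add_mul, ha s, hb s, add_zero]
      zero_mem' := fun s => by rw [mul_zero, zero_mul]
      smul_mem' := fun c x hx s => by
        rw [smul_eq_mul, ← mul_assoc, mul_assoc e]
        exact hx (s * c) }
  have hmem {x : R} : x ∈ L ↔ ∀ s, e * s * x * e' = 0 := Iff.rfl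
  have hPL : P (FGModuleCat.of R (R ⧸ L)) := by
    intro x hx hx'
    obtain ⟨x, rfl⟩ := L.mkQ_surjective x
    have h1 : e' * x - x ∈ L := (Submodule.Quotient.eq L).1 hx
    have h2 : ∀ a ∈ RingHom.ker f, a * x ∈ L := fun a ha =>
      (Submodule.Quotient.mk_eq_zero L).1 (hx' a ha)
    refine (Submodule.Quotient.mk_eq_zero L).2 (hmem.2 fun s => ?_)
    have h3 := hmem.1 h1 s
    -- The hypothesis puts e s e' in J, so e s e' x lies in L; by `h3` this computes e s x e'.
    have h4 := hmem.1 (h2 (e * s * e') (hee' s)) 1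
    rw [mul_sub, sub_mul, sub_eq_zero] at h3
    rw [← h3, ← h4]
    simp only [mul_one, ← mul_assoc, he.eq]
  let L' : Ideal R := L ⊔ RingHom.ker f
  have h1 : (1 : R) ∈ L' := by
    refine (Submodule.Quotient.mk_eq_zero L').1 (prop_quotient_of_torf_subset_serre h hP
      (le_sup_left : L ≤ L') hPL (L'.mkQ 1) ?_ fun a ha => ?_)
    · refine (Submodule.Quotient.eq L').2 (Ideal.mem_sup_left (hmem.2 fun s => ?_))
      change e * s * (e' * 1 - 1) * e' = 0
      rw [mul_one, mul_assoc, sub_mul, he'.eq, one_mul, sub_self, mul_zero]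
    · refine (Submodule.Quotient.mk_eq_zero L').2 (Ideal.mem_sup_right ?_)
      change a * 1 ∈ RingHom.ker f
      rwa [mul_one]
  obtain ⟨l, hl, a, ha, hla⟩ := Submodule.mem_sup.1 h1
  have hu : IsUnit l := by
    rw [eq_sub_of_add_eq hla]
    exact (hf a ha).isUnit_one_sub
  have htop := L.eq_top_of_isUnit_mem hl hu
  have := hmem.1 (htop ▸ Submodule.mem_top : (1 : R) ∈ L) r
  rwa [mul_one] at this

/-- If all torsion-free classes are Serre subcategories, then the ring is Morita equivalent to a
product of local artinian rings, which are corners of the given ring. -/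
theorem exists_isMoritaEquivalent_pi_corner
    (h : torf (FGModuleCat.{u} R) ⊆ serre (FGModuleCat.{u} R)) :
    ∃ (n : ℕ) (e : Fin n → R) (he : ∀ i, IsIdempotentElem (e i)),
      (∀ i, IsLocalRing (he i).Corner ∧ IsArtinianRing (he i).Corner) ∧
        IsMoritaEquivalent ℤ R (∀ i, (he i).Corner) := by
  have := isArtinianRing_of_torf_subset_serre h
  obtain ⟨n, D, d, hD, hd, f, hf, hker⟩ := IsArtinianRing.exists_ringHom_pi_matrix R
  obtain ⟨e, he, hfe⟩ := OrthogonalIdempotents.lift_of_isNilpotent_ker f hker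
    (matrixCornerIdempotent_orthogonal D (d := d)) (fun i => hf _)
  have hfe (i) : f (e i) = matrixCornerIdempotent D i := congrFun hfe i
  refine ⟨n, e, he.idem, fun i => ⟨?_, (he.idem i).isArtinianRing_corner⟩, ?_⟩
  -- Elements lifting the identity of the corner differ from 1 by a nilpotent.
  · have hunit {c : (he.idem i).Corner} (hc : f c.1 = matrixCornerIdempotent D i) : IsUnit c := by
      have hnil : IsNilpotent (1 - c) := (he.idem i).isNilpotent_of_isNilpotent_val
        (hker _ (show f (e i - c.1) = 0 by rw [map_sub, hfe, hc, sub_self]))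
      simpa using hnil.isUnit_one_sub
    have : Nontrivial (he.idem i).Corner := by
      refine ⟨0, 1, fun h01 => matrixCornerIdempotent_ne_zero D (d := d) i ?_⟩
      rw [← hfe, ← IsIdempotentElem.Corner.val_one (he.idem i), ← h01,
        IsIdempotentElem.Corner.val_zero, map_zero]
    refine IsLocalRing.of_isUnit_or_isUnit_one_sub_self fun c => ?_
    have hc : matrixCornerIdempotent D i * f c.1 * matrixCornerIdempotent D i = f c.1 := by
      rw [← hfe, ← map_mul, ← map_mul, IsIdempotentElem.Corner.mul_val,
        IsIdempotentElem.Corner.val_mul]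
    have hEc : matrixCornerIdempotent D i * f c.1 = f c.1 := by
      rw [← hfe, ← map_mul, IsIdempotentElem.Corner.mul_val]
    have hcE : f c.1 * matrixCornerIdempotent D i = f c.1 := by
      rw [← hfe, ← map_mul, IsIdempotentElem.Corner.val_mul]
    by_cases h0 : f c.1 = 0
    · exact Or.inr ((he.idem i).isNilpotent_of_isNilpotent_val (hker _ h0)).isUnit_one_sub
    · obtain ⟨t, ht, ht'⟩ :=
        exists_inverse_of_matrixCornerIdempotent_mul_mul_ne_zero D hc h0
      obtain ⟨t, rfl⟩ := hf t
      have hE := (matrixCornerIdempotent_orthogonal D (d := d)).idem i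
      have h1 : IsUnit ((he.idem i).toCorner t * c) := hunit (by
        rw [IsIdempotentElem.Corner.val_mul_val, IsIdempotentElem.toCorner_val]
        simp only [map_mul, hfe, mul_assoc, hEc, ht, hE.eq])
      have h2 : IsUnit (c * (he.idem i).toCorner t) := hunit (by
        rw [IsIdempotentElem.Corner.val_mul_val, IsIdempotentElem.toCorner_val]
        simp only [map_mul, hfe, ← mul_assoc, hcE, ht', hE.eq])
      obtain ⟨b, hb, -⟩ := isUnit_iff_exists.1 h2
      obtain ⟨b', -, hb'⟩ := isUnit_iff_exists.1 h1
      exact Or.inl (isUnit_iff_exists_and_exists.2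
        ⟨⟨_, (mul_assoc _ _ _).symm.trans hb⟩, ⟨_, (mul_assoc _ _ _).trans hb'⟩⟩)
  · have hzero : ∀ i j, i ≠ j → ∀ r, e i * r * e j = 0 := fun i j hij =>
      mul_mul_eq_zero_of_torf_subset_serre h f hker (he.idem i) (he.idem j) fun r => by
        rw [map_mul, map_mul, hfe, hfe, matrixCornerIdempotent_mul_mul D hij]
    obtain ⟨a, b, hab⟩ := exists_sum_mul_matrixCornerIdempotent_mul_eq_one D (d := d)
    choose a' ha' using fun k => hf (a k)
    choose b' hb' using fun k => hf (b k)
    -- The lifted coefficients give 1 only modulo the nil kernel; the inverse v corrects this.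
    have hu : IsUnit (∑ k, a' k * (∑ i, e i) * b' k) := by
      have : IsNilpotent (1 - ∑ k, a' k * (∑ i, e i) * b' k) := by
        refine hker _ ?_
        rw [RingHom.mem_ker]
        simp only [map_sub, map_sum, map_mul, map_one, ha', hb', hfe, hab, sub_self]
      simpa using this.isUnit_one_sub
    obtain ⟨v, -, hv⟩ := isUnit_iff_exists.1 hu
    have hfull : ∑ k, (v * a' k) * (∑ i, e i) * b' k = 1 := by
      rw [← hv, Finset.mul_sum]
      simp only [mul_assoc]
    exact (he.isIdempotentElem_sum.isMoritaEquivalent_corner hfull).trans ℤ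
      (.of_algEquiv ℤ (he.cornerSumRingEquiv hzero).toIntAlgEquiv)

variable {Λ : Type u} [Ring Λ] [IsNoetherianRing Λᵐᵒᵖ]

theorem isMoritaToProdArtinianLocal_of_torf_subset_serre
    (h : torf (RMod Λ) ⊆ serre (RMod Λ)) : IsMoritaToProdArtinianLocal Λ := by
  obtain ⟨n, e, he, hloc, hmor⟩ := exists_isMoritaEquivalent_pi_corner h
  -- The corners are taken in Λᵐᵒᵖ, so the local rings sought are their opposites.
  refine ⟨n, fun i => ((he i).Corner)ᵐᵒᵖ, inferInstance, fun i => ⟨?_, ?_⟩, ?_⟩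
  · have := (hloc i).1
    exact IsLocalRing.of_isUnit_or_isUnit_one_sub_self fun a =>
      (IsLocalRing.isUnit_or_isUnit_of_add_one (add_sub_cancel a.unop 1)).imp (fun h => h.op) fun h => h.op
  · have := (hloc i).2
    exact (RingEquiv.opOp (he i).Corner).isArtinianRing
  · refine hmor.trans ℤ (.of_algEquiv ℤ (RingEquiv.toIntAlgEquiv ?_))
    exact ((RingEquiv.piMulOpposite _).trans
      (RingEquiv.piCongrRight fun i => (RingEquiv.opOp (he i).Corner).symm)).symm

end SubcatClasses

/-! ### Simple modules at a local central idempotent -/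

section SimpleModules

variable {R : Type*} [Ring R]

/-- Multiplication by a central element. -/
def centralSMul {ε : R} (hc : ∀ r, ε * r = r * ε) (M : Type*) [AddCommGroup M] [Module R M] :
    M →ₗ[R] M where
  toFun m := ε • m
  map_add' := smul_add ε
  map_smul' r m := by rw [RingHom.id_apply, smul_smul, smul_smul, hc]

lemma smul_eq_self_of_isSimpleModule {ε : R} (hε : IsIdempotentElem ε) (hc : ∀ r, ε * r = r * ε)
    {S : Type*} [AddCommGroup S] [Module R S] [IsSimpleModule R S] {x : S} (hx : ε • x ≠ 0)
    (y : S) : ε • y = y := by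
  have hinj : Function.Injective (centralSMul hc S) :=
    (LinearMap.injective_or_eq_zero (centralSMul hc S)).resolve_right
      fun h => hx (LinearMap.congr_fun h x)
  refine hinj ?_
  change ε • ε • y = ε • y
  rw [smul_smul, hε.eq]

/-- A local condition at a central idempotent `ε`: either `a` has a left inverse at `ε` or all
`1 - s * a` have one. -/
def IsLocalAt (ε : R) : Prop :=
  ∀ a : R, (∃ b, b * a * ε = ε) ∨ ∀ s, ∃ u, u * (1 - s * a) * ε = ε

variable {ε : R}

/-- This describes the annihilator of x through ε alone, independently of S and x. If ax ≠ 0, then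
sax = x for some s, so 1 - sa kills x and cannot have a left inverse at ε. -/
lemma IsLocalAt.smul_eq_zero_iff (hloc : IsLocalAt ε) {S : Type*} [AddCommGroup S] [Module R S]
    [IsSimpleModule R S] (hS : ∀ y : S, ε • y = y) {x : S} (hx : x ≠ 0) (a : R) :
    a • x = 0 ↔ ¬ ∃ b, b * a * ε = ε := by
  constructor
  · rintro hax ⟨b, hb⟩
    refine hx ?_
    rw [← hS x, ← hb, mul_smul, hS, mul_smul, hax, smul_zero]
  · intro h
    by_contra hax
    obtain ⟨s, hs⟩ := IsSimpleModule.toSpanSingleton_surjective R hax x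
    obtain ⟨u, hu⟩ := (hloc a).resolve_left h s
    rw [LinearMap.toSpanSingleton_apply, smul_smul] at hs
    refine hx ?_
    rw [← hS x, ← hu, mul_smul, hS, mul_smul, sub_smul, one_smul, hs, sub_self, smul_zero]

lemma IsLocalAt.nonempty_linearEquiv (hloc : IsLocalAt ε) {S T : Type*} [AddCommGroup S]
    [Module R S] [IsSimpleModule R S] (hS : ∀ y : S, ε • y = y) [AddCommGroup T]
    [Module R T] [IsSimpleModule R T] (hT : ∀ y : T, ε • y = y) : Nonempty (S ≃ₗ[R] T) := by
  have := IsSimpleModule.nontrivial R S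
  have := IsSimpleModule.nontrivial R T
  obtain ⟨x, hx⟩ := exists_ne (0 : S)
  obtain ⟨y, hy⟩ := exists_ne (0 : T)
  have hker : LinearMap.ker (LinearMap.toSpanSingleton R S x) =
      LinearMap.ker (LinearMap.toSpanSingleton R T y) := by
    ext a
    rw [LinearMap.mem_ker, LinearMap.mem_ker, LinearMap.toSpanSingleton_apply,
      LinearMap.toSpanSingleton_apply, hloc.smul_eq_zero_iff hS hx, hloc.smul_eq_zero_iff hT hy]
  exact ⟨((LinearMap.quotKerEquivOfSurjective _
    (IsSimpleModule.toSpanSingleton_surjective R hx)).symm.trans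
    (Submodule.quotEquivOfEq _ _ hker)).trans (LinearMap.quotKerEquivOfSurjective _
    (IsSimpleModule.toSpanSingleton_surjective R hy))⟩

/-- The module εM is both an image and a submodule of M. It has a simple quotient and a simple
submodule, and both are isomorphic to S. -/
lemma IsLocalAt.exists_ne_zero (hloc : IsLocalAt ε) (hε : IsIdempotentElem ε)
    (hc : ∀ r, ε * r = r * ε) {M S : Type*} [AddCommGroup M] [Module R M] [AddCommGroup S]
    [Module R S] [IsSimpleModule R S] [IsNoetherian R M] [IsArtinian R M]
    (hS : ∀ y : S, ε • y = y) {m : M} (hm : ε • m ≠ 0) :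
    (∃ g : M →ₗ[R] S, g ≠ 0) ∧ ∃ g : S →ₗ[R] M, g ≠ 0 := by
  set W := LinearMap.range (centralSMul hc M)
  have hWε : ∀ w ∈ W, ε • w = w := by
    rintro _ ⟨z, rfl⟩
    change ε • ε • z = ε • z
    rw [smul_smul, hε.eq]
  have hW0 : W ≠ ⊥ := fun h => hm ((Submodule.mem_bot R).1 (h ▸ ⟨m, rfl⟩))
  constructor
  · have : Nontrivial W := Submodule.nontrivial_iff_ne_bot.2 hW0
    obtain ⟨K, hK, -⟩ := (eq_top_or_exists_le_coatom (⊥ : Submodule R W)).resolve_left bot_ne_top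
    have : IsSimpleModule R (W ⧸ K) := isSimpleModule_iff_isCoatom.2 hK
    obtain ⟨φ⟩ := hloc.nonempty_linearEquiv (S := W ⧸ K) (T := S) (fun y => by
      obtain ⟨w, rfl⟩ := K.mkQ_surjective y
      rw [← map_smul]
      exact congrArg K.mkQ (Subtype.ext (hWε w.1 w.2))) hS
    have hsurj : Function.Surjective (φ.toLinearMap ∘ₗ K.mkQ ∘ₗ (centralSMul hc M).rangeRestrict) :=
      φ.surjective.comp (K.mkQ_surjective.comp (LinearMap.surjective_rangeRestrict _))
    refine ⟨φ.toLinearMap ∘ₗ K.mkQ ∘ₗ (centralSMul hc M).rangeRestrict, fun h0 => ?_⟩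
    have := IsSimpleModule.nontrivial R S
    obtain ⟨s, hs⟩ := exists_ne (0 : S)
    obtain ⟨z, rfl⟩ := hsurj s
    exact hs (LinearMap.congr_fun h0 z)
  · obtain ⟨A, hA, hAW⟩ := (eq_bot_or_exists_atom_le W).resolve_left hW0
    have : IsSimpleModule R A := isSimpleModule_iff_isAtom.2 hA
    obtain ⟨φ⟩ := hloc.nonempty_linearEquiv hS (T := A)
      (fun y => Subtype.ext (hWε y.1 (hAW y.2)))
    refine ⟨A.subtype ∘ₗ φ.toLinearMap, fun h0 => ?_⟩
    have := IsSimpleModule.nontrivial R S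
    obtain ⟨s, hs⟩ := exists_ne (0 : S)
    exact hs (A.subtype_injective.comp φ.injective
      ((LinearMap.congr_fun h0 s).trans (map_zero (A.subtype ∘ₗ φ.toLinearMap)).symm))

end SimpleModules

/-! ### Finite products of local rings -/

section PiLocal

variable {ι : Type*} [DecidableEq ι] {Γ : ι → Type*} [∀ i, Ring (Γ i)]

lemma isLocalAt_op_single (i : ι) [IsLocalRing (Γ i)] :
    IsLocalAt (MulOpposite.op (Pi.single i 1) : (∀ i, Γ i)ᵐᵒᵖ) := by
  have hinv {a : (∀ i, Γ i)ᵐᵒᵖ} {b : Γ i} (h : a.unop i * b = 1) :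
      MulOpposite.op (Pi.single i b) * a * MulOpposite.op (Pi.single i 1) =
        MulOpposite.op (Pi.single i 1) := by
    refine MulOpposite.unop_injective (funext fun j => ?_)
    rcases eq_or_ne j i with rfl | hj
    · simp [h]
    · simp [hj]
  intro a
  refine or_iff_not_imp_left.2 fun ha s => ?_
  -- The product s * a in the opposite ring has component a_i s_i, and a right inverse of a_i
  -- becomes a left inverse there.
  rcases IsLocalRing.isUnit_or_isUnit_of_add_one
    (add_sub_cancel (a.unop i * s.unop i) 1) with hu | hu
  · obtain ⟨v, hv, -⟩ := isUnit_iff_exists.1 hu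
    exact (ha ⟨_, hinv ((mul_assoc _ _ _).symm.trans hv)⟩).elim
  · obtain ⟨v, hv, -⟩ := isUnit_iff_exists.1 hu
    exact ⟨_, hinv (a := 1 - s * a) hv⟩

/-- Over a product of local rings, a simple subquotient of a module of finite length receives and
emits a nonzero map from and to the module. -/
lemma exists_ne_zero_of_pi_isLocalRing [Fintype ι] [∀ i, IsLocalRing (Γ i)] {M N S : Type*} [AddCommGroup M]
    [Module (∀ i, Γ i)ᵐᵒᵖ M] [AddCommGroup S] [Module (∀ i, Γ i)ᵐᵒᵖ S] [AddCommGroup N]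
    [Module (∀ i, Γ i)ᵐᵒᵖ N] [IsSimpleModule (∀ i, Γ i)ᵐᵒᵖ S] [IsNoetherian (∀ i, Γ i)ᵐᵒᵖ M]
    [IsArtinian (∀ i, Γ i)ᵐᵒᵖ M] {i : N →ₗ[(∀ i, Γ i)ᵐᵒᵖ] M} (hi : Function.Injective i)
    {f : N →ₗ[(∀ i, Γ i)ᵐᵒᵖ] S} (hf : f ≠ 0) :
    (∃ g : M →ₗ[(∀ i, Γ i)ᵐᵒᵖ] S, g ≠ 0) ∧ ∃ g : S →ₗ[(∀ i, Γ i)ᵐᵒᵖ] M, g ≠ 0 := by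
  obtain ⟨n, hn⟩ : ∃ n, f n ≠ 0 := by
    by_contra! h
    exact hf (LinearMap.ext h)
  let ε : ι → (∀ i, Γ i)ᵐᵒᵖ := fun i => MulOpposite.op (Pi.single i 1)
  have hsum : ∑ k, ε k = 1 := by
    refine MulOpposite.unop_injective ?_
    rw [Finset.unop_sum]
    exact Finset.univ_sum_single (1 : ∀ i, Γ i)
  have hidem (k) : IsIdempotentElem (ε k) := by
    refine MulOpposite.unop_injective ?_
    change Pi.single k 1 * Pi.single k 1 = Pi.single k 1
    rw [← Pi.single_mul, mul_one]
  have hc (k) (r : (∀ i, Γ i)ᵐᵒᵖ) : ε k * r = r * ε k := by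
    refine MulOpposite.unop_injective (funext fun j => ?_)
    rcases eq_or_ne j k with rfl | hj
    · simp [ε]
    · simp [ε, hj]
  obtain ⟨k, hk⟩ : ∃ k, ε k • f n ≠ 0 := by
    by_contra! h
    refine hn ?_
    rw [← one_smul (∀ i, Γ i)ᵐᵒᵖ (f n), ← hsum, Finset.sum_smul]
    exact Finset.sum_eq_zero fun k _ => h k
  refine (isLocalAt_op_single k).exists_ne_zero (hidem k) (hc k) (m := i n)
    (smul_eq_self_of_isSimpleModule (hidem k) (hc k) hk) fun h0 => hk ?_
  have h0 : ε k • i n = 0 := h0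
  rw [← map_smul] at h0
  rw [← map_smul, (map_eq_zero_iff i hi).1 h0, map_zero]

end PiLocal

/-! ### Submodules under an equivalence, and simple subquotients -/

section Transport

variable {R : Type u} [Ring R] {R' : Type u} [Ring R'] (E : ModuleCat.{u} R ≌ ModuleCat.{u} R')

/-- An equivalence of module categories preserves submodule lattices. -/
noncomputable def submoduleOrderIsoOfEquivalence (M : ModuleCat.{u} R) :
    Submodule R M ≃o Submodule R' (E.functor.obj M) :=
  (ModuleCat.subobjectModule M).symm.trans
    ((Subobject.lowerEquivalence (MonoOver.congr M E)).toOrderIso.trans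
      (ModuleCat.subobjectModule (E.functor.obj M)))

/-- The simple module `S` is a subquotient of `M`. -/
def OccursIn (R : Type u) [Ring R] (S M : Type u) [AddCommGroup S] [Module R S] [AddCommGroup M]
    [Module R M] : Prop :=
  ∃ (N : ModuleCat.{u} R) (i : N →ₗ[R] M) (f : N →ₗ[R] S), Function.Injective i ∧ f ≠ 0

lemma OccursIn.of_injective {S M M' : Type u} [AddCommGroup S] [Module R S] [AddCommGroup M]
    [Module R M] [AddCommGroup M'] [Module R M'] (h : OccursIn R S M) {j : M →ₗ[R] M'}
    (hj : Function.Injective j) : OccursIn R S M' :=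
  have ⟨N, i, f, hi, hf⟩ := h
  ⟨N, j ∘ₗ i, f, hj.comp hi, hf⟩

lemma OccursIn.of_surjective {S M M' : Type u} [AddCommGroup S] [Module R S] [AddCommGroup M]
    [Module R M] [AddCommGroup M'] [Module R M'] (h : OccursIn R S M) {p : M' →ₗ[R] M}
    (hp : Function.Surjective p) : OccursIn R S M' := by
  obtain ⟨N, i, f, hi, hf⟩ := h
  let K : Submodule R M' := (LinearMap.range i).comap p
  let q : K →ₗ[R] LinearMap.range i := p.restrict fun _ hx => hx
  have hq : Function.Surjective q := by
    rintro ⟨_, n, rfl⟩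
    obtain ⟨m, hm⟩ := hp (i n)
    exact ⟨⟨m, n, hm.symm⟩, Subtype.ext hm⟩
  refine ⟨ModuleCat.of R K, K.subtype,
    f ∘ₗ (LinearEquiv.ofInjective i hi).symm.toLinearMap ∘ₗ q, K.subtype_injective, fun h0 => ?_⟩
  refine hf (LinearMap.ext fun n => ?_)
  obtain ⟨x, hx⟩ := ((LinearEquiv.ofInjective i hi).symm.surjective.comp hq) n
  rw [← hx]
  exact LinearMap.congr_fun h0 x

end Transport

/-! ### From a product of artinian local rings to IE-closed subcategories -/

namespace SubcatClasses

variable {Λ : Type u} [Ring Λ] [IsNoetherianRing Λᵐᵒᵖ]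

/-- Chain conditions, simplicity and nonzero maps all transport along the equivalence. By Schur's
lemma a nonzero map to, or from, a simple module is surjective, respectively injective. -/
lemma finite_length_of_isMoritaToProdArtinianLocal (h : IsMoritaToProdArtinianLocal Λ)
    (M : Type u) [AddCommGroup M] [Module Λᵐᵒᵖ M] [Module.Finite Λᵐᵒᵖ M] :
    IsArtinian Λᵐᵒᵖ M ∧ ∀ (S : Type u) [AddCommGroup S] [Module Λᵐᵒᵖ S] [IsSimpleModule Λᵐᵒᵖ S],
      OccursIn Λᵐᵒᵖ S M →
      (∃ g : M →ₗ[Λᵐᵒᵖ] S, Function.Surjective g) ∧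
        ∃ g : S →ₗ[Λᵐᵒᵖ] M, Function.Injective g := by
  obtain ⟨n, Γ, _, hΓ, ⟨⟨E⟩⟩⟩ := h
  have := E.linear
  have hloc : ∀ i, IsLocalRing (Γ i) := fun i => (hΓ i).1
  have hart : ∀ i, IsArtinianRing (Γ i)ᵐᵒᵖ := fun i => (hΓ i).2
  have : IsArtinianRing (∀ i, Γ i)ᵐᵒᵖ := (RingEquiv.piMulOpposite Γ).symm.isArtinianRing
  let F := E.eqv.functor
  have : IsNoetherian Λᵐᵒᵖ M := inferInstance
  have : IsNoetherian (∀ i, Γ i)ᵐᵒᵖ (F.obj (ModuleCat.of Λᵐᵒᵖ M)) :=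
    isNoetherian_iff'.2
      (submoduleOrderIsoOfEquivalence E.eqv (ModuleCat.of Λᵐᵒᵖ M)).symm.strictMono.wellFoundedGT
  have : IsArtinian (∀ i, Γ i)ᵐᵒᵖ (F.obj (ModuleCat.of Λᵐᵒᵖ M)) := inferInstance
  refine ⟨?_, fun S _ _ _ ⟨N, i, f, hi, hf⟩ => ?_⟩
  · exact (submoduleOrderIsoOfEquivalence E.eqv (ModuleCat.of Λᵐᵒᵖ M)).strictMono.wellFoundedLT
  have : IsSimpleModule (∀ i, Γ i)ᵐᵒᵖ (F.obj (ModuleCat.of Λᵐᵒᵖ S)) :=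
    (isSimpleModule_iff _ _).2
      ((submoduleOrderIsoOfEquivalence E.eqv (ModuleCat.of Λᵐᵒᵖ S)).isSimpleOrder_iff.1
        ((isSimpleModule_iff _ _).1 inferInstance))
  have : Mono (ModuleCat.ofHom i) := (ModuleCat.mono_iff_injective _).2 hi
  have hi' := (ModuleCat.mono_iff_injective (F.map (ModuleCat.ofHom i))).1 inferInstance
  have hf' : (F.map (ModuleCat.ofHom f)).hom ≠ 0 := by
    intro h0
    have : F.map (ModuleCat.ofHom f) = 0 := ModuleCat.hom_ext h0
    exact hf (ModuleCat.hom_ext_iff.1 ((F.map_eq_zero_iff).1 this))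
  obtain ⟨⟨g, hg⟩, g', hg'⟩ := exists_ne_zero_of_pi_isLocalRing hi' hf'
  constructor
  · obtain ⟨k, hk⟩ := F.map_surjective (ModuleCat.ofHom g)
    refine ⟨k.hom, (LinearMap.surjective_or_eq_zero k.hom).resolve_right fun h0 => hg ?_⟩
    rw [show k = 0 from ModuleCat.hom_ext h0, F.map_zero] at hk
    exact (ModuleCat.hom_ext_iff.1 hk).symm
  · obtain ⟨k, hk⟩ := F.map_surjective (ModuleCat.ofHom g')
    refine ⟨k.hom, (LinearMap.injective_or_eq_zero k.hom).resolve_right fun h0 => hg' ?_⟩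
    rw [show k = 0 from ModuleCat.hom_ext h0, F.map_zero] at hk
    exact (ModuleCat.hom_ext_iff.1 hk).symm

lemma prop_of_isFiniteLength {R : Type u} [Ring R] [IsNoetherianRing R]
    {P : ObjectProperty (FGModuleCat.{u} R)} (hP : IsSubcategory P)
    [P.IsClosedUnderExtensions] {X : Type u} [AddCommGroup X] [Module R X]
    (hX : IsFiniteLength R X) : ∀ [Module.Finite R X]
    (_ : ∀ (S : Type u) [AddCommGroup S] [Module R S] [Module.Finite R S] [IsSimpleModule R S],
      OccursIn R S X → P (FGModuleCat.of R S)), P (FGModuleCat.of R X) := by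
  have := hP.containsZero
  have := hP.closedUnderIso
  induction hX with
  | @of_subsingleton M _ _ _ =>
    intro _ _
    refine P.prop_of_isZero ?_
    rw [IsZero.iff_id_eq_zero]
    ext x
    exact Subsingleton.elim (α := M) _ _
  | @of_simple_quotient M _ _ N _ _ ih =>
    intro _ h
    refine prop_of_submodule P (M := FGModuleCat.of R M) N
      (ih fun S _ _ _ _ hS => h S (hS.of_injective N.subtype_injective)) (h (M ⧸ N) ?_)
    refine ⟨ModuleCat.of R M, LinearMap.id, N.mkQ, Function.injective_id, fun h0 => ?_⟩
    have := IsSimpleModule.nontrivial R (M ⧸ N)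
    obtain ⟨y, hy⟩ := exists_ne (0 : M ⧸ N)
    obtain ⟨x, rfl⟩ := N.mkQ_surjective y
    exact hy (LinearMap.congr_fun h0 x)

theorem ie_subset_serre_of_isMoritaToProdArtinianLocal (h : IsMoritaToProdArtinianLocal Λ) :
    ie (RMod Λ) ⊆ serre (RMod Λ) := by
  rintro P ⟨hP, hI, hE⟩
  have := hP.closedUnderIso
  -- Comparing simple subquotients treats submodules and quotients of Y at once.
  have key (X Y : RMod Λ) (hY : P Y) (hXY : ∀ (S : Type u) [AddCommGroup S] [Module Λᵐᵒᵖ S],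
      OccursIn Λᵐᵒᵖ S X → OccursIn Λᵐᵒᵖ S Y) : P X := by
    have := (finite_length_of_isMoritaToProdArtinianLocal h X).1
    refine prop_of_isFiniteLength hP (X := X)
      (isFiniteLength_iff_isNoetherian_isArtinian.2 ⟨inferInstance, this⟩) fun S _ _ _ _ hS => ?_
    obtain ⟨⟨f, hf⟩, g, hg⟩ :=
      (finite_length_of_isMoritaToProdArtinianLocal h Y).2 S (hXY S hS)
    exact hI.prop_of_surjective_injective P (S := FGModuleCat.of Λᵐᵒᵖ S) f g hf hg hY hY
  exact ⟨hP, ⟨fun f _ hY => key _ _ hY fun S _ _ hS => hS.of_injective (injective_of_mono f)⟩,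
    ⟨fun f _ hX => key _ _ hX fun S _ _ hS => hS.of_surjective (surjective_of_epi f)⟩, hE⟩

end SubcatClasses

/-! ### The equivalence -/

open SubcatClasses in
theorem theorem3p4 (Λ : Type u) [Ring Λ] [IsNoetherianRing Λᵐᵒᵖ] :
    List.TFAE [
      IsMoritaToProdArtinianLocal Λ,
      serre (RMod Λ) = ie (RMod Λ),
      serre (RMod Λ) = tors (RMod Λ) ∧ tors (RMod Λ) = torf (RMod Λ) ∧
        torf (RMod Λ) = wide (RMod Λ) ∧ wide (RMod Λ) = ice (RMod Λ) ∧
        ice (RMod Λ) = ike (RMod Λ) ∧ ike (RMod Λ) = ie (RMod Λ),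
      serre (RMod Λ) = torf (RMod Λ)] := by
  tfae_have 1 → 2 := fun h => ((serre_subset_tors _).trans (tors_subset_ie _)).antisymm
    (ie_subset_serre_of_isMoritaToProdArtinianLocal h)
  tfae_have 2 → 3 := by
    intro h
    rw [eq_serre_of_serre_eq_ie h (serre_subset_tors _) (tors_subset_ie _),
      eq_serre_of_serre_eq_ie h (serre_subset_torf _) (torf_subset_ie _),
      eq_serre_of_serre_eq_ie h (serre_subset_wide _) (wide_subset_ie _),
      eq_serre_of_serre_eq_ie h (serre_subset_ice _) (ice_subset_ie _),
      eq_serre_of_serre_eq_ie h (serre_subset_ike _) (ike_subset_ie _), ← h]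
    exact ⟨rfl, rfl, rfl, rfl, rfl, rfl⟩
  tfae_have 3 → 4 := fun h => h.1.trans h.2.1
  tfae_have 4 → 1 := fun h => isMoritaToProdArtinianLocal_of_torf_subset_serre h.ge
  tfae_finish
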